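/- Let $a_j>0$ and $b_j\in\mathbb C$ ($j\ge 0$) satisfy $\sup_{j\ge0}(|a_j|+|b_j|)<\infty$, and let $J$ be the bounded operator on $\ell^2(\mathbb N_0)$ given by the symmetric tri-diagonal Jacobi matrix with diagonal $(b_0,b_1,\dots)$ and off-diagonal $(a_0,a_1,\dots)$. Write $\langle\cdot,\cdot\rangle$ for inner products linear in the first and antilinear in the second argument, $\delta_0=(1,0,0,\dots)$, and $|J|=\sqrt{J^*J}$. Let $\nu$ be the spectral measure of $|J|$ corresponding to $\delta_0$, i.e. $\nu(\Delta)=\langle\chi_\Delta(|J|)\delta_0,\delta_0\rangle$. Let $\psi\in L^\infty(\nu)$ be the phase function of $J$, i.e. the unique element of $L^\infty(\nu)$ with $\psi(0)=1$, $|\psi(s)|\le1$ for $\nu$-a.e. $s\ge0$, and $$\langle Jf(|J|)\delta_0,\delta_0\rangle=\int_0^\infty s f(s)\psi(s)\,d\nu(s)\qquad\text{for all } f\in C(\mathbb R).$$ Let $q_j$ be the polynomials defined by $q_0=1$ and the antilinear recurrence $Jq(s)=s\,\overline q(s)$, i.e. $$b_0q_0(s)+a_0q_1(s)=s\,\overline{q_0(s)},\qquad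 a_{j-1}q_{j-1}(s)+b_jq_j(s)+a_jq_{j+1}(s)=s\,\overline{q_j(s)}\quad(j\ge1)$$ for real $s$. Then for all $j,k\ge0$ the following integrals converge absolutely and $$\frac12\int_0^\infty\left\langle\begin{pmatrix}1+\operatorname{Re}\psi(s)&-i\operatorname{Im}\psi(s)\\ i\operatorname{Im}\psi(s)&1-\operatorname{Re}\psi(s)\end{pmatrix}\begin{pmatrix}q_j(s)\\q_j(-s)\end{pmatrix},\begin{pmatrix}q_k(s)\\q_k(-s)\end{pmatrix}\right\rangle_{\mathbb C^2}d\nu(s)=\delta_{j,k},$$ and, equivalently, $$\int_0^\infty\left\langle\begin{pmatrix}1&\overline{\psi(s)}\\ \psi(s)&1\end{pmatrix}\begin{pmatrix}q_j^{\rm o}(s)\\q_j^{\rm e}(s)\end{pmatrix},\begin{pmatrix}q_k^{\rm o}(s)\\q_k^{\rm e}(s)\end{pmatrix}\right\rangle_{\mathbb C^2}d\nu(s)=\delta_{j,k},$$ where $q_j^{\rm e}(s)=\frac{q_j(s)+q_j(-s)}2$ and $q_j^{\rm o}(s)=\frac{q_j(s)-q_j(-s)}2$. Here $\int_0^\infty$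 is the integral over $[0,\infty)$. -/

import Mathlib

open MeasureTheory Polynomial Matrix
open scoped ComplexConjugate InnerProductSpace

noncomputable section

namespace ComplexJacobi

/-- The Hilbert space `ℓ²(ℕ₀)`. -/
abbrev Ell2 : Type := lp (fun _ : ℕ => ℂ) 2

/-- The standard basis vector `δ_j` of `ℓ²(ℕ₀)`. -/
def delta (j : ℕ) : Ell2 := lp.single 2 j (1 : ℂ)

/-- The action of the tri-diagonal matrix with diagonal `b` and off-diagonal `a` on a column
vector `x`: `(J x)_0 = b_0 x_0 + a_0 x_1`, `(J x)_{n+1} = a_n x_n + b_{n+1} x_{n+1} + a_{n+1} x_{n+2}`. -/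
def jacobiAct (a : ℕ → ℝ) (b : ℕ → ℂ) (x : ℕ → ℂ) : ℕ → ℂ
  | 0 => b 0 * x 0 + (a 0 : ℂ) * x 1
  | n + 1 => (a n : ℂ) * x n + b (n + 1) * x (n + 1) + (a (n + 1) : ℂ) * x (n + 2)

theorem jacobiAct_sq_le {a : ℕ → ℝ} {b : ℕ → ℂ} {M : ℝ} (hM : ∀ j, |a j| + ‖b j‖ ≤ M)
    (x : ℕ → ℂ) (n : ℕ) :
    ‖jacobiAct a b x n‖ ^ 2 ≤
      3 * M ^ 2 * ((if n = 0 then 0 else ‖x (n - 1)‖ ^ 2) + ‖x n‖ ^ 2 + ‖x (n + 1)‖ ^ 2) := by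
  have ha : ∀ j, |a j| ≤ M := fun j => by linarith [hM j, norm_nonneg (b j)]
  have hb : ∀ j, ‖b j‖ ≤ M := fun j => by linarith [hM j, abs_nonneg (a j)]
  have hM0 : 0 ≤ M := (abs_nonneg _).trans (ha 0)
  have key : ∀ u v w : ℝ, (M * u + M * v + M * w) ^ 2 ≤ 3 * M ^ 2 * (u ^ 2 + v ^ 2 + w ^ 2) := by
    intro u v w
    nlinarith [mul_nonneg (sq_nonneg M) (sq_nonneg (u - v)),
      mul_nonneg (sq_nonneg M) (sq_nonneg (u - w)), mul_nonneg (sq_nonneg M) (sq_nonneg (v - w))]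
  have hax : ∀ i j, ‖(a i : ℂ) * x j‖ ≤ M * ‖x j‖ := fun i j => by
    rw [norm_mul, Complex.norm_real, Real.norm_eq_abs]
    exact mul_le_mul_of_nonneg_right (ha i) (norm_nonneg _)
  have hbx : ∀ i j, ‖b i * x j‖ ≤ M * ‖x j‖ := fun i j => by
    rw [norm_mul]
    exact mul_le_mul_of_nonneg_right (hb i) (norm_nonneg _)
  cases n with
  | zero =>
    have h : ‖jacobiAct a b x 0‖ ≤ M * 0 + M * ‖x 0‖ + M * ‖x 1‖ := by
      have := norm_add_le (b 0 * x 0) ((a 0 : ℂ) * x 1)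
      have h1 := hbx 0 0
      have h2 := hax 0 1
      simp only [jacobiAct]
      linarith
    have := (pow_le_pow_left₀ (norm_nonneg _) h 2).trans (key 0 ‖x 0‖ ‖x 1‖)
    simpa using this
  | succ n =>
    have h : ‖jacobiAct a b x (n + 1)‖ ≤ M * ‖x n‖ + M * ‖x (n + 1)‖ + M * ‖x (n + 2)‖ := by
      have := norm_add₃_le (a := (a n : ℂ) * x n) (b := b (n + 1) * x (n + 1))
        (c := (a (n + 1) : ℂ) * x (n + 2))
      have h1 := hbx (n + 1) (n + 1)
      have h2 := hax n n
      have h3 := hax (n + 1) (n + 2)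
      simp only [jacobiAct]
      linarith
    have := (pow_le_pow_left₀ (norm_nonneg _) h 2).trans (key _ _ _)
    simpa using this

theorem summable_sq (x : Ell2) : Summable fun n => ‖x n‖ ^ 2 := by
  have := lp.memℓp x
  rw [memℓp_gen_iff (by norm_num)] at this
  simpa using this

theorem norm_sq_eq (x : Ell2) : ‖x‖ ^ 2 = ∑' n, ‖x n‖ ^ 2 := by
  have := lp.norm_rpow_eq_tsum (p := 2) (by norm_num) x
  simpa using this

theorem summable_shift {f : ℕ → ℝ} (hf : Summable f) :
    Summable (fun n => if n = 0 then 0 else f (n - 1)) ∧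
      ∑' n, (if n = 0 then 0 else f (n - 1)) = ∑' n, f n := by
  have h : Summable (fun n => if n = 0 then 0 else f (n - 1)) := by
    rw [← summable_nat_add_iff 1]
    simpa using hf
  refine ⟨h, ?_⟩
  rw [h.tsum_eq_zero_add]
  simp

theorem summable_bound (x : Ell2) :
    Summable (fun n => (if n = 0 then 0 else ‖x (n - 1)‖ ^ 2) + ‖x n‖ ^ 2 + ‖x (n + 1)‖ ^ 2) ∧
      ∑' n, ((if n = 0 then 0 else ‖x (n - 1)‖ ^ 2) + ‖x n‖ ^ 2 + ‖x (n + 1)‖ ^ 2)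
        ≤ 3 * ‖x‖ ^ 2 := by
  have hx := summable_sq x
  obtain ⟨h1, h1'⟩ := summable_shift hx
  have h2 : Summable (fun n => ‖x (n + 1)‖ ^ 2) := (summable_nat_add_iff 1).2 hx
  refine ⟨(h1.add hx).add h2, ?_⟩
  rw [(h1.add hx).tsum_add h2, h1.tsum_add hx, h1', norm_sq_eq]
  have h3 := hx.tsum_eq_zero_add
  have h4 : 0 ≤ ‖x 0‖ ^ 2 := by positivity
  linarith

theorem jacobiAct_memℓp {a : ℕ → ℝ} {b : ℕ → ℂ} {M : ℝ} (hM : ∀ j, |a j| + ‖b j‖ ≤ M)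
    (x : Ell2) : Memℓp (jacobiAct a b x) 2 := by
  rw [memℓp_gen_iff (by norm_num)]
  have h := ((summable_bound x).1.mul_left (3 * M ^ 2)).of_nonneg_of_le
    (fun n => by positivity) (jacobiAct_sq_le hM x)
  simpa using h

/-- The bounded operator `J` on `ℓ²(ℕ₀)` given by the Jacobi matrix with diagonal `b` and
off-diagonal `a`, where `sup_j (|a_j| + |b_j|) < ∞`. -/
def jacobiOp (a : ℕ → ℝ) (b : ℕ → ℂ)
    (hbd : BddAbove (Set.range fun j => |a j| + ‖b j‖)) : Ell2 →L[ℂ] Ell2 :=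
  LinearMap.mkContinuousOfExistsBound
    { toFun := fun x => ⟨jacobiAct a b x,
        jacobiAct_memℓp (M := hbd.choose) (fun j => hbd.choose_spec ⟨j, rfl⟩) x⟩
      map_add' := fun x y => Subtype.ext <| funext fun n => by
        change jacobiAct a b (fun i => x i + y i) n = jacobiAct a b x n + jacobiAct a b y n
        cases n <;> simp only [jacobiAct] <;> ring
      map_smul' := fun c x => Subtype.ext <| funext fun n => by
        change jacobiAct a b (fun i => c * x i) n = c * jacobiAct a b x n
        cases n <;> simp only [jacobiAct] <;> ring } <| by
    obtain ⟨M, hM'⟩ := hbd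
    have hM : ∀ j, |a j| + ‖b j‖ ≤ M := fun j => hM' ⟨j, rfl⟩
    have hM0 : 0 ≤ M := le_trans (by positivity) (hM 0)
    refine ⟨3 * M, fun x => ?_⟩
    refine le_of_sq_le_sq ?_ (by positivity)
    rw [norm_sq_eq]
    have hs := (summable_bound x).1.mul_left (3 * M ^ 2)
    have hs' := hs.of_nonneg_of_le (fun n => by positivity) (jacobiAct_sq_le hM x)
    have h1 := hs'.tsum_le_tsum (jacobiAct_sq_le hM x) hs
    rw [tsum_mul_left] at h1
    have h2 := mul_le_mul_of_nonneg_left (summable_bound x).2 (by positivity : 0 ≤ 3 * M ^ 2)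
    calc _ ≤ _ := h1
      _ ≤ _ := h2
      _ = _ := by ring

@[simp]
theorem jacobiOp_apply (a : ℕ → ℝ) (b : ℕ → ℂ)
    (hbd : BddAbove (Set.range fun j => |a j| + ‖b j‖)) (x : Ell2) (n : ℕ) :
    jacobiOp a b hbd x n = jacobiAct a b x n := rfl

section SpectralData

/- `H` is a complex Hilbert space; everything below is used for `H = ℓ²(ℕ₀)` and `v = δ_0`.
Mathlib's inner product `⟪x, y⟫_ℂ` is linear in the second argument. -/
variable {H : Type*} [NormedAddCommGroup H] [InnerProductSpace ℂ H] [CompleteSpace H]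

/-- The positive functional `f ↦ ⟨f(T) v, v⟩` on `C_c(ℝ)`, where `f(T)` is the continuous
functional calculus of the bounded self-adjoint operator `T`. -/
def spectralFunctional (T : H →L[ℂ] H) (v : H) :
    CompactlySupportedContinuousMap ℝ ℝ →ₚ[ℝ] ℝ :=
  PositiveLinearMap.mk₀
    { toFun := fun f => (⟪v, cfc (fun s : ℝ => f s) T v⟫_ℂ).re
      map_add' := fun f g => by
        have h : cfc (fun s : ℝ => (f + g) s) T
            = cfc (fun s : ℝ => f s) T + cfc (fun s : ℝ => g s) T :=
          cfc_add T (fun s : ℝ => f s) (fun s : ℝ => g s)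
            f.continuous.continuousOn g.continuous.continuousOn
        rw [h]
        simp
      map_smul' := fun c f => by
        have h : cfc (fun s : ℝ => (c • f) s) T = c • cfc (fun s : ℝ => f s) T :=
          cfc_const_mul c (fun s : ℝ => f s) T f.continuous.continuousOn
        rw [h]
        simp [inner_smul_right_eq_smul] }
    (fun f hf => by
      have h : 0 ≤ cfc (fun s : ℝ => f s) T := cfc_nonneg fun s _ => hf s
      exact ((ContinuousLinearMap.nonneg_iff_isPositive _).1 h).re_inner_nonneg_right v)

/-- The spectral measure of a bounded self-adjoint operator `T` corresponding to the vector `v`,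
i.e. the Borel measure `Δ ↦ ⟨χ_Δ(T) v, v⟩` on `ℝ`: it is the measure with
`∫ f dμ = ⟨f(T) v, v⟩` for continuous `f`, provided by the Riesz–Markov theorem. -/
def spectralMeasure (T : H →L[ℂ] H) (v : H) : Measure ℝ :=
  RealRMK.rieszMeasure (spectralFunctional T v)

/-- The measure `ν`: the spectral measure of `|J| = √(J* J)` corresponding to `v`. -/
def nu (J : H →L[ℂ] H) (v : H) : Measure ℝ :=
  spectralMeasure (CFC.abs J) v

/-- `ψ` is (a representative of) the phase function of `J` with respect to `v`: an element of
`L^∞(ν)` with `ψ(0) = 1`, `|ψ(s)| ≤ 1` for `ν`-a.e. `s ≥ 0`, and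
`⟨J f(|J|) v, v⟩ = ∫_0^∞ s f(s) ψ(s) dν(s)` for all continuous `f`. -/
structure IsPhaseFunction (J : H →L[ℂ] H) (v : H) (ψ : ℝ → ℂ) : Prop where
  aestronglyMeasurable : AEStronglyMeasurable ψ (nu J v)
  norm_le_one : ∀ᵐ s ∂(nu J v), 0 ≤ s → ‖ψ s‖ ≤ 1
  apply_zero : ψ 0 = 1
  inner_eq_integral : ∀ f : ℝ → ℝ, Continuous f →
    ⟪v, J (cfc f (CFC.abs J) v)⟫_ℂ
      = ∫ s in Set.Ici (0 : ℝ), (s : ℂ) * (f s : ℂ) * ψ s ∂(nu J v)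

/-- The phase function `ψ` of `J`. It is determined by `IsPhaseFunction` uniquely as an element
of `L^∞(ν)`; a representative is chosen here. -/
def phaseFunction (J : H →L[ℂ] H) (v : H) : ℝ → ℂ :=
  Classical.epsilon (IsPhaseFunction J v)

end SpectralData

/-- The polynomial with complex conjugate coefficients, so that `(conjPoly p)(s)` is the complex
conjugate of `p(s)` for real `s`. -/
def conjPoly (p : ℂ[X]) : ℂ[X] := p.map (starRingEnd ℂ)

/-- The polynomials `q_j` with `q_0 = 1` that solve the antilinear recurrence
`b_0 q_0 + a_0 q_1 = s q̄_0`, `a_{j-1} q_{j-1} + b_j q_j + a_j q_{j+1} = s q̄_j` (`j ≥ 1`). -/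
def antiPoly (a : ℕ → ℝ) (b : ℕ → ℂ) : ℕ → ℂ[X]
  | 0 => 1
  | 1 => C ((a 0 : ℂ)⁻¹) * (X - C (b 0))
  | j + 2 => C ((a (j + 1) : ℂ)⁻¹) *
      (X * conjPoly (antiPoly a b (j + 1)) - C (b (j + 1)) * antiPoly a b (j + 1)
        - C (a j : ℂ) * antiPoly a b j)

/-- The function `s ↦ q_j(s)` on the real line. -/
def antiEval (a : ℕ → ℝ) (b : ℕ → ℂ) (j : ℕ) (s : ℝ) : ℂ := (antiPoly a b j).eval (s : ℂ)

/-- Check of the definition: for `a_j ≠ 0` the vector `q(s)` solves `J q(s) = s q̄(s)`. -/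
theorem jacobiAct_antiEval (a : ℕ → ℝ) (b : ℕ → ℂ) (ha : ∀ j, a j ≠ 0) (s : ℝ) (j : ℕ) :
    jacobiAct a b (fun i => antiEval a b i s) j = s * conj (antiEval a b j s) := by
  have ha' : ∀ j, (a j : ℂ) ≠ 0 := fun j => by exact_mod_cast ha j
  have hc : ∀ p : ℂ[X], (conjPoly p).eval (s : ℂ) = conj (p.eval (s : ℂ)) := fun p => by
    have := Polynomial.eval_map_apply (f := starRingEnd ℂ) (p := p) (s : ℂ)
    simpa [conjPoly] using this
  rcases j with _ | j
  · have := ha' 0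
    simp [jacobiAct, antiEval, antiPoly]
    field_simp
    ring
  · have := ha' (j + 1)
    simp only [jacobiAct, antiEval, antiPoly, eval_mul, eval_sub, eval_C, eval_X, hc]
    field_simp
    ring

/-- The even part `q^e(s) = (q(s) + q(-s)) / 2` of a function on the real line. -/
def evenPart (q : ℝ → ℂ) (s : ℝ) : ℂ := (q s + q (-s)) / 2

/-- The odd part `q^o(s) = (q(s) - q(-s)) / 2` of a function on the real line. -/
def oddPart (q : ℝ → ℂ) (s : ℝ) : ℂ := (q s - q (-s)) / 2

/-- The standard inner product of `ℂ²`, linear in the first argument and antilinear in the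
second one. -/
def jap (v w : Fin 2 → ℂ) : ℂ := v ⬝ᵥ star w

/-- The matrix weight in the variables `(q(s), q(-s))`, for the value `z = ψ(s)`. -/
def weight (z : ℂ) : Matrix (Fin 2) (Fin 2) ℂ :=
  !![1 + (z.re : ℂ), -Complex.I * (z.im : ℂ);
     Complex.I * (z.im : ℂ), 1 - (z.re : ℂ)]

/-- The matrix weight in the variables `(q^o(s), q^e(s))`, for the value `z = ψ(s)`. -/
def parityWeight (z : ℂ) : Matrix (Fin 2) (Fin 2) ℂ :=
  !![1, conj z; z, 1]

end ComplexJacobi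

end

/-! Let `C` be coordinatewise conjugation on `ℓ²`. The matrix of `J` is symmetric, so `J* = C J C`,
and the antilinear operator `A = C J` satisfies `A² = J* J = |J|²` and `⟪A x, y⟫ = ⟪A y, x⟫`
(`isConjugated_conjJacobi`). Sending a polynomial `∑ cₙ Xⁿ` to `∑ c̄ₙ Aⁿ δ_0` turns the antilinear
recurrence into the three-term relation for `A δ_j`, so `q_j` goes to `δ_j` (`polyVec_antiPoly`).

Orthonormality of the `δ_j` thus becomes a statement about the moments `⟪Aⁿ δ_0, Aᵐ δ_0⟫`. Since `A`
commutes with `f(|J|)` for real `f`, they are power moments of `ν` when `n` and `m` have equal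
parity, and otherwise moments weighted by `ψ` or its conjugate. This is the form with matrix
`parityWeight` (`integral_parityForm`); the other relation is a linear change of variables
(`jap_weight`).

As `ψ` is a chosen object, its existence has to be shown. Cauchy–Schwarz gives `|⟨J f(|J|) δ_0,
δ_0⟩| ≤ ∫ s |f| dν` (`norm_inner_le`), and a functional dominated in this way has a density of
modulus at most one with respect to `s dν` (`exists_density`). -/

noncomputable section

namespace ComplexJacobi

/-! ### Densities of functionals dominated by an `L¹` norm -/

section Density

open BoundedContinuousFunction

theorem integral_norm_eq_inner {α : Type*} [MeasurableSpace α] {m : Measure α} [IsFiniteMeasure m] (g : Lp ℝ 2 m) :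
    ∫ x, ‖g x‖ ∂m
      = ⟪indicatorConstLp 2 MeasurableSet.univ (measure_ne_top m _) (1 : ℝ), |g|⟫_ℝ := by
  rw [L2.inner_indicatorConstLp_one, Measure.restrict_univ]
  refine integral_congr_ae ?_
  filter_upwards [Lp.coeFn_abs g] with x hx
  rw [hx, Real.norm_eq_abs]

/-- A complex functional on bounded continuous real functions that is dominated by the `L¹` norm
of a finite measure has a density bounded by `1`. -/
theorem exists_density {α : Type*} [TopologicalSpace α] [NormalSpace α]
    [SecondCountableTopology α] [MeasurableSpace α] [BorelSpace α] (m : Measure α) [IsFiniteMeasure m] [m.WeaklyRegular]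
    (L : (α →ᵇ ℝ) →ₗ[ℝ] ℂ) (hL : ∀ f, ‖L f‖ ≤ ∫ x, ‖f x‖ ∂m) :
    ∃ φ : α → ℂ, AEStronglyMeasurable φ m ∧ (∀ᵐ x ∂m, ‖φ x‖ ≤ 1) ∧
      ∀ f : α →ᵇ ℝ, L f = ∫ x, (f x : ℂ) * φ x ∂m := by
  set one : Lp ℝ 2 m := indicatorConstLp 2 MeasurableSet.univ (measure_ne_top m _) (1 : ℝ)
    with hone
  set e : (α →ᵇ ℝ) →L[ℝ] Lp ℝ 2 m := BoundedContinuousFunction.toLp 2 m ℝ with he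
  have hdense : DenseRange e := toLp_denseRange ℝ m ℝ (by simp)
  have hec : ∀ f : α →ᵇ ℝ, e f =ᵐ[m] f := fun f => coeFn_toLp (E := ℝ) 2 m ℝ f
  have hint : ∀ f : α →ᵇ ℝ, ∫ x, ‖f x‖ ∂m = ∫ x, ‖e f x‖ ∂m := fun f =>
    integral_congr_ae (by filter_upwards [hec f] with x hx; rw [hx])
  -- On a finite measure the `L¹` norm is at most `‖1‖₂` times the `L²` norm, so `L` extends to
  -- `L²`, where Riesz representation applies.
  have hbound : ∀ f, ‖L f‖ ≤ ‖one‖ * ‖e.toLinearMap f‖ := fun f => by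
    refine (hL f).trans ?_
    rw [hint, integral_norm_eq_inner]
    refine (real_inner_le_norm _ _).trans ?_
    rw [norm_abs_eq_norm]
    rfl
  set F : Lp ℝ 2 m →L[ℝ] ℂ := L.extendOfNorm e.toLinearMap with hF
  have hFe : ∀ f, F (e f) = L f := fun f =>
    LinearMap.extendOfNorm_eq (f := L) (e := e.toLinearMap) hdense ⟨_, hbound⟩ f
  have hF1 : ∀ g : Lp ℝ 2 m, ‖F g‖ ≤ ∫ x, ‖g x‖ ∂m := fun g => by
    refine hdense.induction_on (p := fun g : Lp ℝ 2 m => ‖F g‖ ≤ ∫ x, ‖g x‖ ∂m) g ?_ ?_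
    · simp_rw [integral_norm_eq_inner]
      refine isClosed_le (by fun_prop) ?_
      exact continuous_const.inner (continuous_id.sup continuous_neg)
    · intro f
      rw [hFe, ← hint]
      exact hL f
  obtain ⟨g₁, hg₁⟩ := (InnerProductSpace.toDual ℝ (Lp ℝ 2 m)).surjective (Complex.reCLM.comp F)
  obtain ⟨g₂, hg₂⟩ := (InnerProductSpace.toDual ℝ (Lp ℝ 2 m)).surjective (Complex.imCLM.comp F)
  have hre : ∀ h, ⟪g₁, h⟫_ℝ = (F h).re := fun h => by
    rw [← InnerProductSpace.toDual_apply_apply (𝕜 := ℝ), hg₁]; rfl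
  have him : ∀ h, ⟪g₂, h⟫_ℝ = (F h).im := fun h => by
    rw [← InnerProductSpace.toDual_apply_apply (𝕜 := ℝ), hg₂]; rfl
  have hi : ∀ g : Lp ℝ 2 m, Integrable g m := fun g =>
    (Lp.memLp g).integrable (by norm_num)
  have hset : ∀ (g : Lp ℝ 2 m) {s : Set α} (hs : MeasurableSet s),
      ⟪g, indicatorConstLp 2 hs (measure_ne_top m s) (1 : ℝ)⟫_ℝ = ∫ x in s, g x ∂m := by
    intro g s hs
    rw [real_inner_comm, L2.inner_indicatorConstLp_one]
  -- The modulus is bounded one direction `u` at a time by testing on indicators. The null set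
  -- depends on `u`, hence the passage to a countable dense set of directions below.
  have hdir : ∀ u : ℂ, ∀ᵐ x ∂m, u.re * g₁ x + u.im * g₂ x ≤ ‖u‖ := by
    intro u
    refine ae_le_of_forall_setIntegral_le (((hi g₁).const_mul _).add ((hi g₂).const_mul _))
      (integrable_const _) fun s hs _ => ?_
    rw [integral_add ((hi g₁).const_mul _).integrableOn ((hi g₂).const_mul _).integrableOn,
      integral_const_mul, integral_const_mul, ← hset g₁ hs, ← hset g₂ hs, hre, him]
    set w := F (indicatorConstLp 2 hs (measure_ne_top m s) (1 : ℝ))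
    have hw : ‖w‖ ≤ m.real s := by
      refine (hF1 _).trans (le_of_eq ?_)
      rw [integral_congr_ae (g := s.indicator 1), integral_indicator_one hs]
      filter_upwards [indicatorConstLp_coeFn (p := 2) (hs := hs) (hμs := measure_ne_top m s)
        (c := (1 : ℝ))] with x hx
      rw [hx]
      by_cases h : x ∈ s <;> simp [h]
    have h1 : u.re * w.re + u.im * w.im = (conj u * w).re := by simp
    rw [h1]
    refine (Complex.re_le_norm _).trans ?_
    rw [norm_mul, Complex.norm_conj, setIntegral_const, smul_eq_mul, mul_comm]
    exact mul_le_mul_of_nonneg_right hw (norm_nonneg _)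
  have hall : ∀ᵐ x ∂m, ∀ n, (TopologicalSpace.denseSeq ℂ n).re * g₁ x
      + (TopologicalSpace.denseSeq ℂ n).im * g₂ x ≤ ‖TopologicalSpace.denseSeq ℂ n‖ :=
    ae_all_iff.2 fun n => hdir _
  have hm1 := (Lp.aestronglyMeasurable g₁)
  have hm2 := (Lp.aestronglyMeasurable g₂)
  refine ⟨fun x => (g₁ x : ℂ) + (g₂ x : ℂ) * Complex.I, ?_, ?_, ?_⟩
  · exact (Complex.continuous_ofReal.comp_aestronglyMeasurable hm1).add
      ((Complex.continuous_ofReal.comp_aestronglyMeasurable hm2).mul_const _)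
  · filter_upwards [hall] with x hx
    have hu : ∀ u : ℂ, u.re * g₁ x + u.im * g₂ x ≤ ‖u‖ := fun u =>
      (TopologicalSpace.denseRange_denseSeq ℂ).induction_on
        (p := fun u : ℂ => u.re * g₁ x + u.im * g₂ x ≤ ‖u‖) u
        (isClosed_le (by fun_prop) (by fun_prop)) hx
    -- The direction `u = z` gives `‖z‖² ≤ ‖z‖`.
    set z : ℂ := (g₁ x : ℂ) + (g₂ x : ℂ) * Complex.I
    have h2 := hu z
    have h3 : z.re * g₁ x + z.im * g₂ x = ‖z‖ ^ 2 := by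
      rw [← Complex.normSq_eq_norm_sq, Complex.normSq_apply]; simp [z]
    rw [h3] at h2
    nlinarith [norm_nonneg z]
  · intro f
    have hf1 : ∀ g : Lp ℝ 2 m, Integrable (fun x => f x * g x) m := fun g =>
      (hi g).bdd_mul f.continuous.aestronglyMeasurable (c := ‖f‖)
        (Filter.Eventually.of_forall fun x => f.norm_coe_le_norm x)
    have hf2 : ∀ g : Lp ℝ 2 m, ⟪g, e f⟫_ℝ = ∫ x, f x * g x ∂m := fun g => by
      rw [L2.inner_def]
      refine integral_congr_ae ?_
      filter_upwards [hec f] with x hx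
      rw [hx]; simp
    have h4 : ∀ x, (f x : ℂ) * ((g₁ x : ℂ) + (g₂ x : ℂ) * Complex.I)
        = ((f x * g₁ x : ℝ) : ℂ) + ((f x * g₂ x : ℝ) : ℂ) * Complex.I := fun x => by
      push_cast; ring
    simp_rw [h4]
    rw [integral_add (hf1 g₁).ofReal ((hf1 g₂).ofReal.mul_const _), integral_mul_const,
      integral_complex_ofReal, integral_complex_ofReal, ← hf2, ← hf2, hre, him, hFe,
      Complex.re_add_im]

end Density

/-! ### Spectral measure and existence of the phase function -/

section Spectral

variable {H : Type*} [NormedAddCommGroup H] [InnerProductSpace ℂ H] [CompleteSpace H]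

theorem spectralFunctional_apply (T : H →L[ℂ] H) (v : H)
    (f : CompactlySupportedContinuousMap ℝ ℝ) :
    spectralFunctional T v f = (⟪v, cfc (fun s : ℝ => f s) T v⟫_ℂ).re := rfl

instance regular_spectralMeasure (T : H →L[ℂ] H) (v : H) : (spectralMeasure T v).Regular :=
  RealRMK.regular_rieszMeasure _

/-- By inner regularity it is enough to exclude compact sets of positive measure. A Urysohn function
equal to `1` on such a set and `0` on the spectrum has zero functional calculus. -/
theorem spectralMeasure_compl_spectrum (T : H →L[ℂ] H) (v : H) :
    spectralMeasure T v (spectrum ℝ T)ᶜ = 0 := by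
  by_contra hne
  have hcl : IsClosed (spectrum ℝ T) := (spectrum.isCompact T).isClosed
  obtain ⟨K, hKs, hK, hlt⟩ := hcl.isOpen_compl.exists_lt_isCompact (pos_iff_ne_zero.2 hne)
  obtain ⟨f, hf1, hf0, hfc, hf⟩ := exists_continuous_one_zero_of_isCompact hK hcl
    (Set.disjoint_left.2 fun x hx => hKs hx)
  set F : CompactlySupportedContinuousMap ℝ ℝ := ⟨f, hfc⟩
  have h := RealRMK.rieszMeasure_le_of_eq_one (spectralFunctional T v) (f := F)
    (fun x => (hf x).1) hK (fun x hx => hf1 hx)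
  have h0 : cfc (fun s : ℝ => F s) T = 0 := by
    refine (cfc_congr (g := fun _ => (0 : ℝ)) fun x hx => hf0 hx).trans ?_
    exact cfc_const_zero ℝ T
  rw [spectralFunctional_apply, h0] at h
  simp only [_root_.zero_apply, inner_zero_right, Complex.zero_re, ENNReal.ofReal_zero] at h
  exact absurd hlt (not_lt.2 h)

theorem ae_mem_spectrum (T : H →L[ℂ] H) (v : H) :
    ∀ᵐ s ∂(spectralMeasure T v), s ∈ spectrum ℝ T :=
  spectralMeasure_compl_spectrum T v

instance isFiniteMeasure_spectralMeasure (T : H →L[ℂ] H) (v : H) :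
    IsFiniteMeasure (spectralMeasure T v) := by
  refine ⟨?_⟩
  rw [← Set.union_compl_self (spectrum ℝ T)]
  refine (measure_union_le _ _).trans_lt ?_
  rw [spectralMeasure_compl_spectrum, add_zero]
  exact (spectrum.isCompact T).measure_lt_top

/-- Both the functional calculus and the measure see only the compact spectrum, so this truncation
carries the Riesz–Markov formula from `C_c(ℝ)` to all continuous functions. -/
theorem exists_eqOn_spectrum (T : H →L[ℂ] H) {f : ℝ → ℝ} (hf : Continuous f) :
    ∃ g : CompactlySupportedContinuousMap ℝ ℝ, Set.EqOn f g (spectrum ℝ T) := by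
  obtain ⟨χ, h1, -, hc, -⟩ := exists_continuous_one_zero_of_isCompact (spectrum.isCompact T)
    (isClosed_empty (X := ℝ)) (Set.disjoint_empty _)
  refine ⟨⟨⟨fun s => f s * χ s, by fun_prop⟩, hc.mul_left⟩, fun s hs => ?_⟩
  change f s = f s * χ s
  rw [h1 hs]
  simp

theorem integrable_spectralMeasure (T : H →L[ℂ] H) (v : H) {f : ℝ → ℝ} (hf : Continuous f) :
    Integrable f (spectralMeasure T v) := by
  obtain ⟨g, hg⟩ := exists_eqOn_spectrum T hf
  refine (g.continuous.integrable_of_hasCompactSupport g.hasCompactSupport).congr ?_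
  filter_upwards [ae_mem_spectrum T v] with s hs
  exact (hg hs).symm

theorem integral_spectralMeasure (T : H →L[ℂ] H) (v : H) {f : ℝ → ℝ} (hf : Continuous f) :
    ∫ s, f s ∂(spectralMeasure T v) = (⟪v, cfc f T v⟫_ℂ).re := by
  obtain ⟨g, hg⟩ := exists_eqOn_spectrum T hf
  rw [cfc_congr hg, ← spectralFunctional_apply, ← RealRMK.integral_rieszMeasure]
  refine integral_congr_ae ?_
  filter_upwards [ae_mem_spectrum T v] with s hs
  exact hg hs

theorem norm_cfc_apply_sq {T : H →L[ℂ] H} (hT : IsSelfAdjoint T) (v : H) {f : ℝ → ℝ}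
    (hf : Continuous f) :
    ‖cfc f T v‖ ^ 2 = ∫ s, f s ^ 2 ∂(spectralMeasure T v) := by
  have hsa : IsSelfAdjoint (cfc f T) := cfc_predicate f T
  rw [integral_spectralMeasure T v (by fun_prop : Continuous fun s => f s ^ 2),
    cfc_pow f 2 T hf.continuousOn, pow_two (cfc f T), mul_apply_eq_comp,
    ← ContinuousLinearMap.adjoint_inner_left, ← ContinuousLinearMap.star_eq_adjoint, hsa.star_eq,
    inner_self_eq_norm_sq_to_K]
  norm_cast

theorem ae_nonneg_spectralMeasure {T : H →L[ℂ] H} (hT : 0 ≤ T) (v : H) :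
    ∀ᵐ s ∂(spectralMeasure T v), 0 ≤ s := by
  filter_upwards [ae_mem_spectrum T v] with s hs
  exact spectrum_nonneg_of_nonneg hT hs

theorem ae_nonneg_nu (J : H →L[ℂ] H) (v : H) : ∀ᵐ s ∂(nu J v), 0 ≤ s :=
  ae_nonneg_spectralMeasure (CFC.abs_nonneg J) v

/-- An antilinear operator that commutes with a self-adjoint operator commutes with its real
functional calculus. -/
theorem cfc_commute_antilinear (A : H →L⋆[ℂ] H) {S : H →L[ℂ] H}
    (h : ∀ x, A (S x) = S (A x)) (hS : IsSelfAdjoint S) (f : ℝ → ℝ) (x : H) :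
    A (cfc f S x) = cfc f S (A x) := by
  revert x
  -- The induction runs over the closed real algebra generated by `S`: an antilinear map commutes
  -- with real scalars only.
  refine StarAlgebra.elemental.induction_on ℝ (cfc_mem_elemental f S)
    (P := fun u _ => ∀ x, A (u x) = u (A x)) h (by rwa [hS.star_eq]) ?_ ?_ ?_ ?_
  · intro r x
    simp [Algebra.algebraMap_eq_smul_one, ← Complex.coe_smul]
  · intro u _ w _ hu hw x
    simp [hu, hw]
  · intro u _ w _ hu hw x
    simp [hu, hw]
  · intro s _ hs w hw x
    have hcl : IsClosed {u : H →L[ℂ] H | A (u x) = u (A x)} :=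
      isClosed_eq (by fun_prop) (by fun_prop)
    exact closure_minimal (fun u hu => hs u hu x) hcl hw

theorem norm_abs_apply (J : H →L[ℂ] H) (x : H) : ‖CFC.abs J x‖ = ‖J x‖ := by
  have hsa : IsSelfAdjoint (CFC.abs J) := (CFC.abs_nonneg J).isSelfAdjoint
  have h : ‖CFC.abs J x‖ ^ 2 = ‖J x‖ ^ 2 := by
    have h1 : ⟪CFC.abs J x, CFC.abs J x⟫_ℂ = ⟪J x, J x⟫_ℂ := by
      rw [← ContinuousLinearMap.adjoint_inner_right, ← ContinuousLinearMap.adjoint_inner_right,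
        ← ContinuousLinearMap.star_eq_adjoint, ← ContinuousLinearMap.star_eq_adjoint, hsa.star_eq,
        ← mul_apply_eq_comp, ← mul_apply_eq_comp, CFC.abs_mul_abs]
    rw [inner_self_eq_norm_sq_to_K, inner_self_eq_norm_sq_to_K] at h1
    exact_mod_cast h1
  exact (sq_eq_sq₀ (norm_nonneg _) (norm_nonneg _)).1 h

/-- `A` commutes with `A² = J* J`, hence with its square root `|J|`, hence with real functions of
`|J|`. -/
theorem cfc_abs_commute_antilinear (A : H →L⋆[ℂ] H) {J : H →L[ℂ] H}
    (hsq : ∀ x, A (A x) = (star J * J) x) (f : ℝ → ℝ) (x : H) :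
    A (cfc f (CFC.abs J) x) = cfc f (CFC.abs J) (A x) := by
  refine cfc_commute_antilinear A (fun x => ?_) (CFC.abs_nonneg J).isSelfAdjoint f x
  have h0 : (0 : H →L[ℂ] H) ≤ star J * J := star_mul_self_nonneg J
  rw [CFC.abs, CFC.sqrt_eq_real_sqrt _ h0, cfcₙ_eq_cfc]
  exact cfc_commute_antilinear A (fun x => by rw [← hsq, ← hsq]) (IsSelfAdjoint.star_mul_self J) _ x

/-- The defining properties of the antilinear symmetric square root `A = C J` of `J* J`, where `C`
is a conjugation that fixes `v`. -/
structure IsConjugated (A : H →L⋆[ℂ] H) (J : H →L[ℂ] H) (v : H) : Prop where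
  symm : ∀ x y, ⟪A x, y⟫_ℂ = ⟪A y, x⟫_ℂ
  sq : ∀ x, A (A x) = (star J * J) x
  inner_left : ∀ x, ⟪A x, v⟫_ℂ = ⟪v, J x⟫_ℂ

namespace IsConjugated

variable {A : H →L⋆[ℂ] H} {J : H →L[ℂ] H} {v : H}

theorem norm_apply (h : IsConjugated A J v) (x : H) : ‖A x‖ = ‖CFC.abs J x‖ := by
  rw [norm_abs_apply]
  have h1 : ⟪A x, A x⟫_ℂ = ⟪J x, J x⟫_ℂ := by
    rw [h.symm, h.sq, mul_apply_eq_comp, ContinuousLinearMap.star_eq_adjoint,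
      ContinuousLinearMap.adjoint_inner_left]
  rw [inner_self_eq_norm_sq_to_K, inner_self_eq_norm_sq_to_K] at h1
  have h2 : ‖A x‖ ^ 2 = ‖J x‖ ^ 2 := by exact_mod_cast h1
  exact (sq_eq_sq₀ (norm_nonneg _) (norm_nonneg _)).1 h2

/-- Commuting `h(|J|)` past `A` rewrites the pairing as `⟪A g(|J|) v, h(|J|) v⟫`; then
Cauchy–Schwarz and `‖A x‖ = ‖|J| x‖` apply. -/
theorem norm_inner_mul_sq_le (hA : IsConjugated A J v) {g h : ℝ → ℝ} (hg : Continuous g)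
    (hh : Continuous h) :
    ‖⟪v, J (cfc (fun s => h s * g s) (CFC.abs J) v)⟫_ℂ‖ ^ 2
      ≤ (∫ s, (s * g s) ^ 2 ∂(nu J v)) * ∫ s, h s ^ 2 ∂(nu J v) := by
  have hsa : IsSelfAdjoint (CFC.abs J) := (CFC.abs_nonneg J).isSelfAdjoint
  have hsh : IsSelfAdjoint (cfc h (CFC.abs J)) := cfc_predicate h _
  rw [nu, ← norm_cfc_apply_sq hsa v hh, ← norm_cfc_apply_sq hsa v (by fun_prop), ← mul_pow]
  refine pow_le_pow_left₀ (norm_nonneg _) ?_ 2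
  rw [← hA.inner_left, cfc_mul h g _ hh.continuousOn hg.continuousOn,
    mul_apply_eq_comp, cfc_abs_commute_antilinear A hA.sq,
    ← ContinuousLinearMap.adjoint_inner_right, ← ContinuousLinearMap.star_eq_adjoint, hsh.star_eq]
  refine (norm_inner_le_norm _ _).trans ?_
  rw [hA.norm_apply, cfc_mul (fun s => s) g _ (by fun_prop) hg.continuousOn, cfc_id' ℝ _,
    mul_apply_eq_comp]

/-- Formally, splitting `f = h g` with `h² = s |f|` makes both Cauchy–Schwarz factors equal to `∫ s
|f| dν`. This `h` may vanish, so `h²` is perturbed by `ε`, which then tends to `0`. -/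
theorem norm_inner_le (hA : IsConjugated A J v) {f : ℝ → ℝ} (hf : Continuous f) :
    ‖⟪v, J (cfc f (CFC.abs J) v)⟫_ℂ‖ ≤ ∫ s, s * |f s| ∂(nu J v) := by
  have hnn := ae_nonneg_nu J v
  have hint : ∀ {u : ℝ → ℝ}, Continuous u → Integrable u (nu J v) := fun hu =>
    integrable_spectralMeasure _ v hu
  set D := ∫ s, s * |f s| ∂(nu J v) with hD
  have hD0 : 0 ≤ D := integral_nonneg_of_ae (by
    filter_upwards [hnn] with s hs using mul_nonneg hs (abs_nonneg _))
  set E := ∫ s, (|f s| + max s 0) ∂(nu J v) with hE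
  set N := ∫ _, (1 : ℝ) ∂(nu J v) with hN
  have key : ∀ ε : ℝ, 0 < ε →
      ‖⟪v, J (cfc f (CFC.abs J) v)⟫_ℂ‖ ^ 2 ≤ D * (D + ε * E + ε ^ 2 * N) := by
    intro ε hε
    -- `max s 0` keeps `w` positive and continuous on the whole line; it equals `s` almost
    -- everywhere.
    set w : ℝ → ℝ := fun s => (|f s| + ε) * (max s 0 + ε) with hw
    have hw0 : ∀ s, 0 < w s := fun s => by positivity
    have hwc : Continuous w := by fun_prop
    have hsw : ∀ s, √(w s) ≠ 0 := fun s => (Real.sqrt_pos.2 (hw0 s)).ne'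
    have hfc : f = fun s => √(w s) * (f s / √(w s)) := by
      funext s
      field_simp [hsw s]
    have h1 := hA.norm_inner_mul_sq_le (g := fun s => f s / √(w s)) (h := fun s => √(w s))
      (hf.div (by fun_prop) hsw) (by fun_prop)
    rw [← hfc] at h1
    refine h1.trans ?_
    have h2 : ∫ s, √(w s) ^ 2 ∂(nu J v) = D + ε * E + ε ^ 2 * N := by
      rw [hD, hE, hN, ← integral_const_mul, ← integral_const_mul,
        ← integral_add (hint (by fun_prop)) (hint (by fun_prop)),
        ← integral_add (hint (by fun_prop)) (hint (by fun_prop))]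
      refine integral_congr_ae ?_
      filter_upwards [hnn] with s hs
      rw [Real.sq_sqrt (hw0 s).le]
      simp only [hw, max_eq_left hs]
      ring
    rw [h2]
    refine mul_le_mul_of_nonneg_right ?_ (h2 ▸ integral_nonneg fun s => sq_nonneg _)
    refine integral_mono_ae (hint ?_) (hint (by fun_prop)) ?_
    · exact (continuous_id.mul (hf.div (by fun_prop) hsw)).pow 2
    · filter_upwards [hnn] with s hs
      rw [mul_pow, div_pow, Real.sq_sqrt (hw0 s).le, ← mul_div_assoc, div_le_iff₀ (hw0 s),
        ← sq_abs (f s)]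
      simp only [hw, max_eq_left hs]
      have ha := abs_nonneg (f s)
      have : s * |f s| * ((|f s| + ε) * (s + ε)) - s ^ 2 * |f s| ^ 2
          = s * |f s| * (|f s| * ε + ε * s + ε ^ 2) := by ring
      have h3 : 0 ≤ s * |f s| * (|f s| * ε + ε * s + ε ^ 2) := by positivity
      linarith
  have hlim : Filter.Tendsto (fun ε : ℝ => D * (D + ε * E + ε ^ 2 * N))
      (nhdsWithin 0 (Set.Ioi 0)) (nhds (D * (D + 0 * E + 0 ^ 2 * N))) :=
    (Continuous.tendsto (by fun_prop) 0).mono_left nhdsWithin_le_nhds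
  have h4 := ge_of_tendsto hlim (by filter_upwards [self_mem_nhdsWithin] with ε hε using key ε hε)
  refine le_of_sq_le_sq ?_ hD0
  linarith

/-- The functional `f ↦ ⟨J f(|J|) v, v⟩` on bounded continuous functions. -/
def functional (J : H →L[ℂ] H) (v : H) : BoundedContinuousFunction ℝ ℝ →ₗ[ℝ] ℂ where
  toFun f := ⟪v, J (cfc (fun s => f s) (CFC.abs J) v)⟫_ℂ
  map_add' f g := by
    have h : cfc (fun s => (f + g) s) (CFC.abs J)
        = cfc (fun s => f s) (CFC.abs J) + cfc (fun s => g s) (CFC.abs J) :=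
      cfc_add _ _ _ f.continuous.continuousOn g.continuous.continuousOn
    rw [h]
    simp
  map_smul' c f := by
    have h : cfc (fun s => (c • f) s) (CFC.abs J) = c • cfc (fun s => f s) (CFC.abs J) :=
      cfc_const_mul c _ _ f.continuous.continuousOn
    rw [h, ← Complex.coe_smul]
    simp

theorem exists_isPhaseFunction (hA : IsConjugated A J v) : ∃ ψ, IsPhaseFunction J v ψ := by
  have hnn := ae_nonneg_nu J v
  have hfin : IsFiniteMeasure (nu J v) := isFiniteMeasure_spectralMeasure _ v
  have hint : ∀ {u : ℝ → ℝ}, Continuous u → Integrable u (nu J v) := fun hu =>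
    integrable_spectralMeasure _ v hu
  set m : Measure ℝ := (nu J v).withDensity fun s => (Real.toNNReal s : ENNReal) with hm
  have hmfin : IsFiniteMeasure m :=
    isFiniteMeasure_withDensity_ofReal (hint continuous_id).hasFiniteIntegral
  have hmint : ∀ {E : Type} [NormedAddCommGroup E] [NormedSpace ℝ E] (g : ℝ → E),
      ∫ s, g s ∂m = ∫ s, s • g s ∂(nu J v) := by
    intro E _ _ g
    rw [hm, integral_withDensity_eq_integral_smul measurable_real_toNNReal]
    refine integral_congr_ae ?_
    filter_upwards [hnn] with s hs
    rw [NNReal.smul_def, Real.coe_toNNReal s hs]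
  obtain ⟨φ, hφm, hφ1, hφ⟩ := exists_density m (functional J v) fun f => by
    rw [hmint]
    exact hA.norm_inner_le f.continuous
  obtain ⟨φ', hφ'm, hφφ'⟩ := hφm
  -- The density is determined only almost everywhere for `s dν`, which ignores `s = 0`. The value
  -- `1` at the exceptional points secures `ψ(0) = 1` and `|ψ| ≤ 1` everywhere, while the factor `s`
  -- hides the change at `0`.
  set ψ : ℝ → ℂ := fun s => if s ≤ 0 ∨ 1 < ‖φ' s‖ then 1 else φ' s with hψ
  have hψφ : ∀ᵐ s : ℝ ∂(nu J v), ((s : ℝ) : ℂ) * φ s = (s : ℂ) * ψ s := by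
    have h1 : ∀ᵐ s ∂m, φ s = φ' s ∧ ‖φ s‖ ≤ 1 := hφφ'.and hφ1
    rw [hm, ae_withDensity_iff (by fun_prop)] at h1
    filter_upwards [h1, hnn] with s hs hs0
    rcases hs0.eq_or_lt with h0 | h0
    · simp [← h0]
    · obtain ⟨h2, h3⟩ := hs (by simpa using h0)
      rw [h2] at h3 ⊢
      simp [hψ, not_or.2 ⟨not_le.2 h0, not_lt.2 h3⟩]
  refine ⟨ψ, ?_, ?_, ?_, ?_⟩
  · refine Measurable.aestronglyMeasurable (Measurable.ite ?_ measurable_const hφ'm.measurable)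
    exact measurableSet_Iic.union (measurableSet_lt measurable_const hφ'm.measurable.norm)
  · refine Filter.Eventually.of_forall fun s _ => ?_
    by_cases h : s ≤ 0 ∨ 1 < ‖φ' s‖
    · simp [hψ, h]
    · simp only [hψ, h, if_false]
      exact not_lt.1 (not_or.1 h).2
  · simp [hψ]
  · intro f hf
    obtain ⟨g, hg⟩ := exists_eqOn_spectrum (CFC.abs J) hf
    obtain ⟨C, hC⟩ := g.hasCompactSupport.exists_bound_of_continuous g.continuous
    have h1 := hφ (BoundedContinuousFunction.ofNormedAddCommGroup g g.continuous C hC)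
    rw [cfc_congr hg, Measure.restrict_eq_self_of_ae_mem (s := Set.Ici (0 : ℝ)) hnn]
    refine h1.trans ?_
    rw [hmint]
    refine integral_congr_ae ?_
    filter_upwards [hψφ, ae_mem_spectrum (CFC.abs J) v] with s hs hsp
    rw [hg hsp, mul_right_comm, ← hs, Complex.real_smul]
    simp only [BoundedContinuousFunction.coe_ofNormedAddCommGroup]
    ring

/-- The chosen function has the defining properties because some phase function exists; any
representative serves. -/
theorem isPhaseFunction_phaseFunction (hA : IsConjugated A J v) :
    IsPhaseFunction J v (phaseFunction J v) :=
  Classical.epsilon_spec hA.exists_isPhaseFunction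

end IsConjugated

end Spectral

/-! ### The antilinear square root of `J* J` -/

section Conjugation

theorem inner_star_left (x y : Ell2) : ⟪star x, y⟫_ℂ = ⟪star y, x⟫_ℂ := by
  rw [lp.inner_eq_tsum, lp.inner_eq_tsum]
  refine tsum_congr fun n => ?_
  simp [mul_comm]

theorem delta_apply (k n : ℕ) : delta k n = if n = k then 1 else 0 := by
  by_cases h : n = k
  · subst h; simp [delta]
  · simp [delta, h]

theorem star_delta (k : ℕ) : star (delta k) = delta k := by
  ext n
  rw [lp.star_apply, delta_apply]
  split_ifs <;> simp

theorem inner_delta_delta (j k : ℕ) : ⟪delta j, delta k⟫_ℂ = if j = k then 1 else 0 := by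
  rw [delta, lp.inner_single_left, delta_apply]
  simp

variable (a : ℕ → ℝ) (b : ℕ → ℂ) (hbd : BddAbove (Set.range fun j => |a j| + ‖b j‖))

theorem jacobiOp_delta_zero :
    jacobiOp a b hbd (delta 0) = b 0 • delta 0 + (a 0 : ℂ) • delta 1 := by
  ext n
  rcases n with _ | _ | n <;>
    simp only [jacobiOp_apply, jacobiAct, delta_apply, lp.coeFn_add, lp.coeFn_smul, Pi.add_apply,
      Pi.smul_apply, smul_eq_mul] <;>
    simp

theorem jacobiOp_delta_succ (k : ℕ) :
    jacobiOp a b hbd (delta (k + 1)) =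
      (a k : ℂ) • delta k + b (k + 1) • delta (k + 1) + (a (k + 1) : ℂ) • delta (k + 2) := by
  ext n
  rcases n with _ | n
  · rcases k with _ | k <;>
      simp only [jacobiOp_apply, jacobiAct, delta_apply, lp.coeFn_add, lp.coeFn_smul, Pi.add_apply,
        Pi.smul_apply, smul_eq_mul] <;>
      simp
  · simp only [jacobiOp_apply, jacobiAct, delta_apply, lp.coeFn_add, lp.coeFn_smul, Pi.add_apply,
      Pi.smul_apply, smul_eq_mul]
    rcases lt_trichotomy n k with h | h | h
    · by_cases h' : n + 1 = k
      · subst h'; simp [show n ≠ n + 1 + 1 by omega]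
      · simp [h.ne, h', show n ≠ k + 1 by omega]
    · subst h; simp
    · by_cases h' : n = k + 1
      · subst h'; simp [show k + 1 + 1 ≠ k by omega]
      · simp [h.ne', h', show n + 1 ≠ k by omega]

/-- The matrix equals its transpose, so its adjoint is its entrywise conjugate. -/
theorem adjoint_jacobiOp_apply (x : Ell2) :
    ContinuousLinearMap.adjoint (jacobiOp a b hbd) x = star (jacobiOp a b hbd (star x)) := by
  ext n
  have h : ∀ y : Ell2, y n = ⟪delta n, y⟫_ℂ := fun y => by
    rw [delta, lp.inner_single_left]; simp
  have hc : ∀ k, ⟪delta k, x⟫_ℂ = x k := fun k => by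
    rw [delta, lp.inner_single_left]; simp
  rw [h, ContinuousLinearMap.adjoint_inner_right, lp.star_apply, jacobiOp_apply]
  rcases n with _ | n
  · rw [jacobiOp_delta_zero]
    simp [inner_add_left, inner_smul_left, hc, jacobiAct, -Complex.coe_smul]
  · rw [jacobiOp_delta_succ]
    simp [inner_add_left, inner_smul_left, hc, jacobiAct, -Complex.coe_smul]

/-- The antilinear operator `x ↦ conj (J x)`. -/
def conjJacobi : Ell2 →L⋆[ℂ] Ell2 :=
  ((starₗᵢ ℂ : Ell2 ≃ₗᵢ⋆[ℂ] Ell2) : Ell2 →L⋆[ℂ] Ell2).comp (jacobiOp a b hbd)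

theorem conjJacobi_apply (x : Ell2) : conjJacobi a b hbd x = star (jacobiOp a b hbd x) := rfl

theorem isConjugated_conjJacobi :
    IsConjugated (conjJacobi a b hbd) (jacobiOp a b hbd) (delta 0) where
  symm x y := by
    rw [conjJacobi_apply, inner_star_left, ← ContinuousLinearMap.adjoint_inner_left,
      adjoint_jacobiOp_apply, star_star, conjJacobi_apply]
  sq x := by
    rw [mul_apply_eq_comp, ContinuousLinearMap.star_eq_adjoint, adjoint_jacobiOp_apply,
      conjJacobi_apply, conjJacobi_apply]
  inner_left x := by rw [conjJacobi_apply, inner_star_left, star_delta]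

end Conjugation

/-! ### Polynomials in an antilinear operator -/

section PolynomialVector

variable {H : Type*} [NormedAddCommGroup H] [InnerProductSpace ℂ H]

/-- The vector `∑ conj(c_n) Aⁿ v` for the polynomial `p = ∑ c_n Xⁿ` and an antilinear `A`. -/
def polyVec (A : H →L⋆[ℂ] H) (v : H) (p : ℂ[X]) : H := p.sum fun n c => conj c • (⇑A)^[n] v

variable (A : H →L⋆[ℂ] H) (v : H)

theorem polyVec_monomial (n : ℕ) (c : ℂ) :
    polyVec A v (monomial n c) = conj c • (⇑A)^[n] v :=
  sum_monomial_index _ _ (by simp)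

theorem polyVec_add (p r : ℂ[X]) : polyVec A v (p + r) = polyVec A v p + polyVec A v r :=
  sum_add_index _ _ _ (by simp) (by simp [add_smul])

theorem polyVec_C_mul (c : ℂ) (p : ℂ[X]) : polyVec A v (C c * p) = conj c • polyVec A v p := by
  induction p using Polynomial.induction_on' with
  | add p r hp hr => rw [mul_add, polyVec_add, polyVec_add, hp, hr, smul_add]
  | monomial n d => rw [C_mul_monomial, polyVec_monomial, polyVec_monomial, map_mul, mul_smul]

theorem polyVec_sub (p r : ℂ[X]) : polyVec A v (p - r) = polyVec A v p - polyVec A v r := by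
  have h : p - r = p + C (-1) * r := by simp [sub_eq_add_neg]
  rw [h, polyVec_add, polyVec_C_mul]
  simp [sub_eq_add_neg]

theorem polyVec_one : polyVec A v 1 = v := by
  rw [← monomial_zero_one, polyVec_monomial]
  simp

/-- Applying `A` raises each power by one and conjugates each coefficient, which matches the right
side `s q̄_j` of the recurrence. -/
theorem polyVec_X_mul_conjPoly (p : ℂ[X]) :
    polyVec A v (X * conjPoly p) = A (polyVec A v p) := by
  induction p using Polynomial.induction_on' with
  | add p r hp hr =>
    rw [polyVec_add, map_add, ← hp, ← hr, ← polyVec_add, conjPoly, Polynomial.map_add, mul_add]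
    rfl
  | monomial n d =>
    rw [conjPoly, map_monomial, X_mul_monomial, polyVec_monomial, polyVec_monomial,
      map_smulₛₗ, Function.iterate_succ_apply']

end PolynomialVector

theorem polyVec_antiPoly {a : ℕ → ℝ} {b : ℕ → ℂ} (ha : ∀ j, a j ≠ 0)
    (hbd : BddAbove (Set.range fun j => |a j| + ‖b j‖)) (j : ℕ) :
    polyVec (conjJacobi a b hbd) (delta 0) (antiPoly a b j) = delta j := by
  have ha' : ∀ j, (a j : ℂ) ≠ 0 := fun j => by exact_mod_cast ha j
  induction j using Nat.twoStepInduction with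
  | zero => exact polyVec_one _ _
  | one =>
    have h : antiPoly a b 1 = C ((a 0 : ℂ)⁻¹) * (X * conjPoly 1 - C (b 0) * 1) := by
      simp [antiPoly, conjPoly]
    rw [h, polyVec_C_mul, polyVec_sub, polyVec_X_mul_conjPoly, polyVec_C_mul, polyVec_one,
      conjJacobi_apply, jacobiOp_delta_zero]
    simp [star_delta, star_smul, smul_smul, ha' 0, -Complex.coe_smul]
  | more j h0 h1 =>
    rw [antiPoly, polyVec_C_mul, polyVec_sub, polyVec_sub, polyVec_X_mul_conjPoly, polyVec_C_mul,
      polyVec_C_mul, h0, h1, conjJacobi_apply, jacobiOp_delta_succ]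
    have h2 : star ((a j : ℂ) • delta j + b (j + 1) • delta (j + 1)
        + (a (j + 1) : ℂ) • delta (j + 2)) - conj (b (j + 1)) • delta (j + 1)
        - conj (a j : ℂ) • delta j = (a (j + 1) : ℂ) • delta (j + 2) := by
      simp only [star_add, star_smul, star_delta, Complex.star_def, Complex.conj_ofReal]
      abel
    rw [h2, smul_smul]
    simp [ha' (j + 1), -Complex.coe_smul]

theorem jap_parityWeight (z o e o' e' : ℂ) :
    jap (parityWeight z *ᵥ ![o, e]) ![o', e']
      = (o + conj z * e) * conj o' + (z * o + e) * conj e' := by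
  simp [jap, parityWeight, dotProduct, Matrix.mulVec, Fin.sum_univ_two]

/-- The substitution `p = o + e`, `p' = e - o` carries one form to the other; the factor `2` cancels
the `1/2` in the first relation. -/
theorem jap_weight (z p p' r r' : ℂ) :
    jap (weight z *ᵥ ![p, p']) ![r, r']
      = 2 * jap (parityWeight z *ᵥ ![(p - p') / 2, (p + p') / 2])
        ![(r - r') / 2, (r + r') / 2] := by
  rw [jap_parityWeight]
  have h1 : jap (weight z *ᵥ ![p, p']) ![r, r']
      = ((1 + z.re) * p + -Complex.I * z.im * p') * conj r
        + (Complex.I * z.im * p + (1 - z.re) * p') * conj r' := by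
    simp [jap, weight, dotProduct, Matrix.mulVec, Fin.sum_univ_two]
  have h2 : z = z.re + z.im * Complex.I := (Complex.re_add_im z).symm
  have h3 : conj z = z.re - z.im * Complex.I := by
    apply Complex.ext <;> simp
  rw [h1, h3]
  conv_rhs => rw [h2]
  simp only [map_div₀, map_sub, map_add, Complex.conj_ofNat, Complex.add_re, Complex.ofReal_re,
    Complex.mul_re, Complex.I_re, Complex.ofReal_im, Complex.I_im, Complex.add_im, Complex.mul_im]
  push_cast
  ring

/-! ### Moments of `A` as integrals against `ν` -/

section Gram

variable {H : Type*} [NormedAddCommGroup H] [InnerProductSpace ℂ H] [CompleteSpace H]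

theorem inner_cfc_self {T : H →L[ℂ] H} (v : H) {f : ℝ → ℝ} (hf : Continuous f) :
    ⟪v, cfc f T v⟫_ℂ = ((∫ s, f s ∂(spectralMeasure T v) : ℝ) : ℂ) := by
  have hsa : IsSelfAdjoint (cfc f T) := cfc_predicate f T
  rw [integral_spectralMeasure T v hf]
  refine (Complex.conj_eq_iff_re.1 ?_).symm
  rw [inner_conj_symm, ← ContinuousLinearMap.adjoint_inner_right,
    ← ContinuousLinearMap.star_eq_adjoint, hsa.star_eq]

namespace IsConjugated

variable {A : H →L⋆[ℂ] H} {J : H →L[ℂ] H} {v : H}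

theorem iterate_even (hA : IsConjugated A J v) (k : ℕ) (x : H) :
    (⇑A)^[2 * k] x = cfc (fun s : ℝ => s ^ (2 * k)) (CFC.abs J) x := by
  have hsa : IsSelfAdjoint (CFC.abs J) := (CFC.abs_nonneg J).isSelfAdjoint
  rw [cfc_pow_id (R := ℝ) (CFC.abs J) (2 * k), pow_mul, pow_two, CFC.abs_mul_abs,
    Function.iterate_mul]
  have h : (⇑A)^[2] = ⇑(star J * J) := funext fun y => hA.sq y
  rw [h]
  induction k with
  | zero => simp
  | succ k ih => rw [Function.iterate_succ_apply', ih, pow_succ', mul_apply_eq_comp (star J * J)]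

theorem inner_iterate_even_even (hA : IsConjugated A J v) (k l : ℕ) :
    ⟪(⇑A)^[2 * k] v, (⇑A)^[2 * l] v⟫_ℂ = ∫ s, (s : ℂ) ^ (2 * k + 2 * l) ∂(nu J v) := by
  have hsk : IsSelfAdjoint (cfc (fun s : ℝ => s ^ (2 * k)) (CFC.abs J)) := cfc_predicate _ _
  rw [hA.iterate_even, hA.iterate_even, ← ContinuousLinearMap.adjoint_inner_right,
    ← ContinuousLinearMap.star_eq_adjoint, hsk.star_eq, ← mul_apply_eq_comp,
    ← cfc_mul _ _ _ (by fun_prop) (by fun_prop), inner_cfc_self v (by fun_prop), nu,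
    ← integral_complex_ofReal]
  simp [pow_add]

/-- Gathering the even powers on one side leaves `⟪v, J |J|^(2k+2l) v⟫`, the defining integral of
`ψ` at `f(s) = s^(2k+2l)`; the remaining factor `s` comes from that definition. -/
theorem inner_iterate_odd_even (hA : IsConjugated A J v) {ψ : ℝ → ℂ} (hψ : IsPhaseFunction J v ψ)
    (k l : ℕ) :
    ⟪(⇑A)^[2 * k + 1] v, (⇑A)^[2 * l] v⟫_ℂ
      = ∫ s, (s : ℂ) ^ (2 * k + 1 + 2 * l) * ψ s ∂(nu J v) := by
  have hnn := ae_nonneg_nu J v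
  have hsl : IsSelfAdjoint (cfc (fun s : ℝ => s ^ (2 * l)) (CFC.abs J)) := cfc_predicate _ _
  rw [Function.iterate_succ_apply', hA.iterate_even, hA.iterate_even,
    ← ContinuousLinearMap.adjoint_inner_left, ← ContinuousLinearMap.star_eq_adjoint, hsl.star_eq,
    ← cfc_abs_commute_antilinear A hA.sq, ← mul_apply_eq_comp,
    ← cfc_mul _ _ _ (by fun_prop) (by fun_prop), hA.inner_left,
    hψ.inner_eq_integral _ (by fun_prop), Measure.restrict_eq_self_of_ae_mem (s := Set.Ici 0) hnn]
  refine integral_congr_ae (Filter.Eventually.of_forall fun s => ?_)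
  push_cast
  ring

/-- The integrand of the second orthogonality relation, for polynomials. -/
def parityForm (ψ : ℝ → ℂ) (p r : ℂ[X]) (s : ℝ) : ℂ :=
  jap (parityWeight (ψ s) *ᵥ ![oddPart (fun s : ℝ => p.eval (s : ℂ)) s,
      evenPart (fun s : ℝ => p.eval (s : ℂ)) s])
    ![oddPart (fun s : ℝ => r.eval (s : ℂ)) s, evenPart (fun s : ℝ => r.eval (s : ℂ)) s]

theorem parityForm_add_left (ψ : ℝ → ℂ) (p p' r : ℂ[X]) :
    parityForm ψ (p + p') r = fun s => parityForm ψ p r s + parityForm ψ p' r s := by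
  funext s
  simp only [parityForm, jap_parityWeight, oddPart, evenPart, eval_add]
  ring

theorem parityForm_add_right (ψ : ℝ → ℂ) (p r r' : ℂ[X]) :
    parityForm ψ p (r + r') = fun s => parityForm ψ p r s + parityForm ψ p r' s := by
  funext s
  simp only [parityForm, jap_parityWeight, oddPart, evenPart, eval_add, map_div₀, map_sub, map_add]
  ring

theorem oddPart_monomial_even (k : ℕ) (c : ℂ) (s : ℝ) :
    oddPart (fun s : ℝ => (monomial (2 * k) c).eval (s : ℂ)) s = 0 := by
  simp [oddPart, pow_mul]

theorem evenPart_monomial_even (k : ℕ) (c : ℂ) (s : ℝ) :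
    evenPart (fun s : ℝ => (monomial (2 * k) c).eval (s : ℂ)) s = c * (s : ℂ) ^ (2 * k) := by
  simp [evenPart, pow_mul]

theorem oddPart_monomial_odd (k : ℕ) (c : ℂ) (s : ℝ) :
    oddPart (fun s : ℝ => (monomial (2 * k + 1) c).eval (s : ℂ)) s
      = c * (s : ℂ) ^ (2 * k + 1) := by
  simp [oddPart, pow_mul, pow_succ]

theorem evenPart_monomial_odd (k : ℕ) (c : ℂ) (s : ℝ) :
    evenPart (fun s : ℝ => (monomial (2 * k + 1) c).eval (s : ℂ)) s = 0 := by
  simp [evenPart, pow_mul, pow_succ]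

theorem parityForm_monomial (hA : IsConjugated A J v) {ψ : ℝ → ℂ} (hψ : IsPhaseFunction J v ψ)
    (n m : ℕ) (c d : ℂ) :
    Integrable (parityForm ψ (monomial n c) (monomial m d)) (nu J v) ∧
      ∫ s, parityForm ψ (monomial n c) (monomial m d) s ∂(nu J v)
        = c * conj d * ⟪(⇑A)^[n] v, (⇑A)^[m] v⟫_ℂ := by
  have hnn := ae_nonneg_nu J v
  have hpow : ∀ N : ℕ, Integrable (fun s : ℝ => (s : ℂ) ^ N) (nu J v) := fun N => by
    have h := (integrable_spectralMeasure (CFC.abs J) v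
      (by fun_prop : Continuous fun s : ℝ => s ^ N)).ofReal (𝕜 := ℂ)
    simpa [nu] using h
  have hψ1 : ∀ᵐ s ∂(nu J v), ‖ψ s‖ ≤ 1 := by
    filter_upwards [hψ.norm_le_one, hnn] with s h hs using h hs
  have hpowψ : ∀ N : ℕ, Integrable (fun s : ℝ => (s : ℂ) ^ N * ψ s) (nu J v) := fun N =>
    (hpow N).mul_bdd hψ.aestronglyMeasurable hψ1
  rcases Nat.even_or_odd' n with ⟨k, rfl | rfl⟩ <;> rcases Nat.even_or_odd' m with ⟨l, rfl | rfl⟩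
  · have h : parityForm ψ (monomial (2 * k) c) (monomial (2 * l) d)
        = fun s : ℝ => c * conj d * (s : ℂ) ^ (2 * k + 2 * l) := by
      funext s
      simp only [parityForm, jap_parityWeight, oddPart_monomial_even, evenPart_monomial_even,
        map_mul, map_pow, Complex.conj_ofReal, map_zero]
      ring
    rw [h, hA.inner_iterate_even_even, integral_const_mul]
    exact ⟨(hpow _).const_mul _, rfl⟩
  · have h : parityForm ψ (monomial (2 * k) c) (monomial (2 * l + 1) d)
        = fun s : ℝ => c * conj d * conj ((s : ℂ) ^ (2 * l + 1 + 2 * k) * ψ s) := by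
      funext s
      simp only [parityForm, jap_parityWeight, oddPart_monomial_even, evenPart_monomial_even,
        oddPart_monomial_odd, evenPart_monomial_odd,
        map_mul, map_pow, Complex.conj_ofReal, map_zero]
      ring
    rw [h, ← inner_conj_symm, hA.inner_iterate_odd_even hψ, integral_const_mul, integral_conj]
    refine ⟨Integrable.const_mul ?_ _, rfl⟩
    exact Complex.conjCLE.toContinuousLinearMap.integrable_comp (hpowψ _)
  · have h : parityForm ψ (monomial (2 * k + 1) c) (monomial (2 * l) d)
        = fun s : ℝ => c * conj d * ((s : ℂ) ^ (2 * k + 1 + 2 * l) * ψ s) := by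
      funext s
      simp only [parityForm, jap_parityWeight, oddPart_monomial_even, evenPart_monomial_even,
        oddPart_monomial_odd, evenPart_monomial_odd,
        map_mul, map_pow, Complex.conj_ofReal, map_zero]
      ring
    rw [h, hA.inner_iterate_odd_even hψ, integral_const_mul]
    exact ⟨(hpowψ _).const_mul _, rfl⟩
  · have h : parityForm ψ (monomial (2 * k + 1) c) (monomial (2 * l + 1) d)
        = fun s : ℝ => c * conj d * (s : ℂ) ^ (2 * (l + 1) + 2 * k) := by
      funext s
      simp only [parityForm, jap_parityWeight, oddPart_monomial_odd, evenPart_monomial_odd,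
        map_mul, map_pow, Complex.conj_ofReal, map_zero]
      ring
    -- Symmetry of `A` moves one factor across, so two odd powers become two even ones.
    have h2 : ⟪(⇑A)^[2 * k + 1] v, (⇑A)^[2 * l + 1] v⟫_ℂ
        = ⟪(⇑A)^[2 * (l + 1)] v, (⇑A)^[2 * k] v⟫_ℂ := by
      rw [Function.iterate_succ_apply' _ (2 * k), hA.symm, ← Function.iterate_succ_apply' (⇑A)]
      rfl
    rw [h, h2, hA.inner_iterate_even_even, integral_const_mul]
    exact ⟨(hpow _).const_mul _, rfl⟩

/-- Both sides are linear in `p` and antilinear in `r`, the conjugated coefficients in `polyVec`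
making up for the inner product being antilinear on the left. Monomials therefore suffice. -/
theorem integral_parityForm (hA : IsConjugated A J v) {ψ : ℝ → ℂ} (hψ : IsPhaseFunction J v ψ)
    (p r : ℂ[X]) :
    Integrable (parityForm ψ p r) (nu J v) ∧
      ∫ s, parityForm ψ p r s ∂(nu J v) = ⟪polyVec A v p, polyVec A v r⟫_ℂ := by
  induction p using Polynomial.induction_on' with
  | add p p' hp hp' =>
    rw [parityForm_add_left, polyVec_add, inner_add_left, integral_add hp.1 hp'.1, hp.2, hp'.2]
    exact ⟨hp.1.add hp'.1, rfl⟩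
  | monomial n c =>
    induction r using Polynomial.induction_on' with
    | add r r' hr hr' =>
      rw [parityForm_add_right, polyVec_add, inner_add_right, integral_add hr.1 hr'.1, hr.2, hr'.2]
      exact ⟨hr.1.add hr'.1, rfl⟩
    | monomial m d =>
      rw [polyVec_monomial, polyVec_monomial, inner_smul_left, inner_smul_right, Complex.conj_conj,
        ← mul_assoc]
      exact hA.parityForm_monomial hψ n m c d

end IsConjugated

end Gram

end ComplexJacobi

end

theorem theorem2p7 (a : ℕ → ℝ) (b : ℕ → ℂ) (ha : ∀ j, 0 < a j)
    (hbd : BddAbove (Set.range fun j => |a j| + ‖b j‖))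
    (J : ComplexJacobi.Ell2 →L[ℂ] ComplexJacobi.Ell2) (hJ : J = ComplexJacobi.jacobiOp a b hbd)
    (ν : Measure ℝ) (hν : ν = ComplexJacobi.nu J (ComplexJacobi.delta 0))
    (ψ : ℝ → ℂ) (hψ : ψ = ComplexJacobi.phaseFunction J (ComplexJacobi.delta 0))
    (q : ℕ → ℝ → ℂ) (hq : q = ComplexJacobi.antiEval a b) (j k : ℕ) :
    (IntegrableOn (fun s : ℝ => ComplexJacobi.jap
        (ComplexJacobi.weight (ψ s) *ᵥ ![q j s, q j (-s)]) ![q k s, q k (-s)]) (Set.Ici 0) ν ∧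
      (1 / 2 : ℂ) * ∫ s in Set.Ici (0 : ℝ), ComplexJacobi.jap
        (ComplexJacobi.weight (ψ s) *ᵥ ![q j s, q j (-s)]) ![q k s, q k (-s)] ∂ν
        = if j = k then 1 else 0) ∧
    (IntegrableOn (fun s : ℝ => ComplexJacobi.jap
        (ComplexJacobi.parityWeight (ψ s) *ᵥ
          ![ComplexJacobi.oddPart (q j) s, ComplexJacobi.evenPart (q j) s])
        ![ComplexJacobi.oddPart (q k) s, ComplexJacobi.evenPart (q k) s]) (Set.Ici 0) ν ∧
      ∫ s in Set.Ici (0 : ℝ), ComplexJacobi.jap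
        (ComplexJacobi.parityWeight (ψ s) *ᵥ
          ![ComplexJacobi.oddPart (q j) s, ComplexJacobi.evenPart (q j) s])
        ![ComplexJacobi.oddPart (q k) s, ComplexJacobi.evenPart (q k) s] ∂ν
        = if j = k then 1 else 0) := by

  have hA : ComplexJacobi.IsConjugated (ComplexJacobi.conjJacobi a b hbd) J
      (ComplexJacobi.delta 0) := hJ ▸ ComplexJacobi.isConjugated_conjJacobi a b hbd
  have hphase : ComplexJacobi.IsPhaseFunction J (ComplexJacobi.delta 0) ψ :=
    hψ ▸ hA.isPhaseFunction_phaseFunction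
  have hnn : ∀ᵐ s ∂ν, s ∈ Set.Ici (0 : ℝ) :=
    hν ▸ ComplexJacobi.ae_nonneg_nu J _
  obtain ⟨hint, hval⟩ := hA.integral_parityForm hphase (ComplexJacobi.antiPoly a b j)
    (ComplexJacobi.antiPoly a b k)
  rw [ComplexJacobi.polyVec_antiPoly (fun j => (ha j).ne') hbd,
    ComplexJacobi.polyVec_antiPoly (fun j => (ha j).ne') hbd,
    ComplexJacobi.inner_delta_delta, ← hν] at hval
  rw [← hν] at hint
  have hform : (fun s : ℝ => ComplexJacobi.jap
        (ComplexJacobi.parityWeight (ψ s) *ᵥ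
          ![ComplexJacobi.oddPart (q j) s, ComplexJacobi.evenPart (q j) s])
        ![ComplexJacobi.oddPart (q k) s, ComplexJacobi.evenPart (q k) s])
      = ComplexJacobi.IsConjugated.parityForm ψ (ComplexJacobi.antiPoly a b j)
        (ComplexJacobi.antiPoly a b k) := by
    rw [hq]
    rfl
  have hform' : (fun s : ℝ => ComplexJacobi.jap
        (ComplexJacobi.weight (ψ s) *ᵥ ![q j s, q j (-s)]) ![q k s, q k (-s)])
      = fun s => 2 * ComplexJacobi.IsConjugated.parityForm ψ (ComplexJacobi.antiPoly a b j)
        (ComplexJacobi.antiPoly a b k) s := by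
    rw [← hform]
    exact funext fun s => ComplexJacobi.jap_weight _ _ _ _ _
  -- `ν` is carried by `[0, ∞)`, so the restriction of the integrals changes nothing.
  rw [IntegrableOn, IntegrableOn, Measure.restrict_eq_self_of_ae_mem hnn, hform, hform',
    integral_const_mul, hval]
  refine ⟨⟨hint.const_mul 2, ?_⟩, hint, rfl⟩
  rw [← mul_assoc]
  norm_num
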